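/- Let $m_0,m\ge 1$ be integers, let $A_{-1},A_0,A_1$ be nonnegative $m\times m$ matrices, and let $B_{-1}$, $B_0$, $B_1$ be nonnegative matrices of sizes $m\times m_0$, $m_0\times m_0$ and $m_0\times m$, all with finite real entries. Put $$K=\begin{pmatrix}B_0&B_1&0&0&\cdots\\ B_{-1}&A_0&A_1&0&\cdots\\ 0&A_{-1}&A_0&A_1&\cdots\\ &\ddots&\ddots&\ddots&\ddots\end{pmatrix},\qquad K_+=\begin{pmatrix}A_0&A_1&0&\cdots\\ A_{-1}&A_0&A_1&\cdots\\ 0&A_{-1}&A_0&\cdots\\ &\ddots&\ddots&\ddots\end{pmatrix},$$ where $K_+$ is $K$ without its first row and column of blocks. For a finite or infinite square matrix $T$ with entries in $[0,\infty]$ (with $0\cdot\infty=0$), $(I-T)^{-1}$ denotes $\sum_{n\ge 0}T^n$, whose entries may be infinite; $T$ is irreducible if for all $i,j$ there is $n\ge 1$ with $(T^n)_{ij}>0$; and $c_p(T)=\sup\{u\ge 0:\ \sum_{n\ge0}u^nT^n \text{ has only finite entries}\}\in[0,\infty]$. For a finite-dimensional nonnegative $T$, $\gamma_{\mathrm{pf}}(T)$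 denotes the Perron–Frobenius eigenvalue of $T$ (the largest eigenvalue having a nonzero nonnegative right eigenvector), with $\gamma_{\mathrm{pf}}(T)=\infty$ if $T$ has an infinite entry. Let $$C_0=B_{-1}(I-B_0)^{-1}B_1+A_0,$$ and let the canonical form $\overline K$ of $K$ be the matrix $K_+$ with its top left block $A_0$ replaced by $C_0$. Let $A_*(\theta)=e^{-\theta}A_{-1}+A_0+e^{\theta}A_1$ for $\theta\in\mathbb R$, and $\Gamma^{(1d)}_+=\{\theta\in\mathbb R:\ \gamma_{\mathrm{pf}}(A_*(\theta))\le 1\}$. Let $N=(I-K_+)^{-1}$, let $N_{11}$ be its top left $m\times m$ block, and let $G_-=N_{11}A_{-1}$. Assume that $K$ is irreducible and that $A_*(0)$ is irreducible. Then: (a) If $\Gamma^{(1d)}_+\ne\emptyset$, then all entries of $N$ are finite, and therefore $G_-$ is well defined and finite. (b) $c_p(\overline K)\ge 1$ if and only if $\Gamma^{(1d)}_+\ne\emptyset$ and $\gamma_{\mathrm{pf}}(C_0+A_1G_-)\le 1$. Moreover, if $\Gamma^{(1d)}_+\neq\emptyset$ and $\gamma_{\mathrm{pf}}(C_0+A_1G_-)=1$,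 then $c_p(\overline K)=1$. -/

import Mathlib

open scoped ENNReal NNReal Matrix

/-- Powers `T ^ n` of a (possibly infinite) square matrix with entries in `[0, ∞]`. -/
noncomputable def nnPow {ι : Type*} [DecidableEq ι] (T : Matrix ι ι ℝ≥0∞) : ℕ → Matrix ι ι ℝ≥0∞
  | 0 => 1
  | n + 1 => Matrix.of fun i j => ∑' k, nnPow T n i k * T k j

/-- `(I - T)⁻¹`, understood as `∑ n, T ^ n`; entries may be infinite. -/
noncomputable def nnNeumann {ι : Type*} [DecidableEq ι] (T : Matrix ι ι ℝ≥0∞) :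
    Matrix ι ι ℝ≥0∞ :=
  Matrix.of fun i j => ∑' n, nnPow T n i j

/-- `T` is irreducible: for each `(i, j)` there is `n ≥ 1` with `(T ^ n) i j > 0`. -/
def NNIrreducible {ι : Type*} [DecidableEq ι] (T : Matrix ι ι ℝ≥0∞) : Prop :=
  ∀ i j, ∃ n : ℕ, 1 ≤ n ∧ 0 < nnPow T n i j

/-- The convergence parameter `sup {u ≥ 0 : ∑ n, u ^ n T ^ n < ∞}`, as an element of `[0, ∞]`;
finiteness of the matrix sum means finiteness of each of its entries. -/
noncomputable def convParam {ι : Type*} [DecidableEq ι] (T : Matrix ι ι ℝ≥0∞) : ℝ≥0∞ :=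
  ⨆ (u : ℝ≥0) (_ : ∀ i j, ∑' n : ℕ, (u : ℝ≥0∞) ^ n * nnPow T n i j < ∞), (u : ℝ≥0∞)

open Classical in
/-- The Perron–Frobenius eigenvalue of a finite-dimensional nonnegative matrix: the largest
eigenvalue that has a nonzero nonnegative right eigenvector. A matrix with an infinite entry
gets the value `∞`. -/
noncomputable def pfEigenvalue {ι : Type*} [Fintype ι] (T : Matrix ι ι ℝ≥0∞) : ℝ≥0∞ :=
  if ∀ i j, T i j ≠ ∞ then
    ⨆ (l : ℝ≥0) (_ : ∃ h : ι → ℝ≥0, h ≠ 0 ∧ ∀ i, ∑ j, T i j * (h j : ℝ≥0∞) = l * h i), (l : ℝ≥0∞)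
  else ∞

/-- A matrix with finite nonnegative entries, regarded as a matrix with entries in `[0, ∞]`. -/
noncomputable def nnCoe {ι κ : Type*} (T : Matrix ι κ ℝ≥0) : Matrix ι κ ℝ≥0∞ :=
  Matrix.of fun i j => (T i j : ℝ≥0∞)

/-- The blocks of a nonnegative matrix with QBD block structure. -/
structure QBDBlocks (m₀ m : ℕ) where
  /-- `A₋₁` -/
  Aneg : Matrix (Fin m) (Fin m) ℝ≥0
  /-- `A₀` -/
  Azero : Matrix (Fin m) (Fin m) ℝ≥0
  /-- `A₁` -/
  Apos : Matrix (Fin m) (Fin m) ℝ≥0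
  /-- `B₋₁`, leading from level `1` to level `0` -/
  Bneg : Matrix (Fin m) (Fin m₀) ℝ≥0
  /-- `B₀` -/
  Bzero : Matrix (Fin m₀) (Fin m₀) ℝ≥0
  /-- `B₁`, leading from level `0` to level `1` -/
  Bpos : Matrix (Fin m₀) (Fin m) ℝ≥0

namespace QBDBlocks

variable {m₀ m : ℕ}

/-- `K₊`: block tridiagonal with `A₋₁, A₀, A₁` in every row of blocks, without boundary
modification. Its first row and column of blocks have index `0` here. -/
noncomputable def Kplus (D : QBDBlocks m₀ m) : Matrix (ℕ × Fin m) (ℕ × Fin m) ℝ≥0∞ :=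
  Matrix.of fun p q =>
    if q.1 = p.1 + 1 then (D.Apos p.2 q.2 : ℝ≥0∞)
    else if q.1 = p.1 then (D.Azero p.2 q.2 : ℝ≥0∞)
    else if p.1 = q.1 + 1 then (D.Aneg p.2 q.2 : ℝ≥0∞)
    else 0

/-- `K`: the first row of blocks is `B₀, B₁, 0, …`, the first column is `B₀, B₋₁, 0, …`, and
removing both leaves `K₊`. -/
noncomputable def K (D : QBDBlocks m₀ m) :
    Matrix (Fin m₀ ⊕ (ℕ × Fin m)) (Fin m₀ ⊕ (ℕ × Fin m)) ℝ≥0∞ :=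
  Matrix.fromBlocks
    (nnCoe D.Bzero)
    (Matrix.of fun i q => if q.1 = 0 then (D.Bpos i q.2 : ℝ≥0∞) else 0)
    (Matrix.of fun p j => if p.1 = 0 then (D.Bneg p.2 j : ℝ≥0∞) else 0)
    D.Kplus

/-- `C₀ = B₋₁ (I - B₀)⁻¹ B₁ + A₀`; entries may be infinite. -/
noncomputable def Czero (D : QBDBlocks m₀ m) : Matrix (Fin m) (Fin m) ℝ≥0∞ :=
  nnCoe D.Bneg * nnNeumann (nnCoe D.Bzero) * nnCoe D.Bpos + nnCoe D.Azero

/-- The canonical form of `K`: the matrix `K₊` with its top left block `A₀` replaced by `C₀`. -/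
noncomputable def Kbar (D : QBDBlocks m₀ m) : Matrix (ℕ × Fin m) (ℕ × Fin m) ℝ≥0∞ :=
  Matrix.of fun p q => if p.1 = 0 ∧ q.1 = 0 then D.Czero p.2 q.2 else D.Kplus p q

/-- `A_*(θ) = e^{-θ} A₋₁ + A₀ + e^θ A₁`. -/
noncomputable def Astar (D : QBDBlocks m₀ m) (θ : ℝ) : Matrix (Fin m) (Fin m) ℝ≥0∞ :=
  Matrix.of fun i j =>
    ENNReal.ofReal (Real.exp (-θ)) * D.Aneg i j + D.Azero i j
      + ENNReal.ofReal (Real.exp θ) * D.Apos i j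

/-- `Γ₊ = {θ ∈ ℝ : γ_pf(A_*(θ)) ≤ 1}`. -/
def GammaPlus (D : QBDBlocks m₀ m) : Set ℝ := {θ | pfEigenvalue (D.Astar θ) ≤ 1}

/-- `N = (I - K₊)⁻¹`. -/
noncomputable def N (D : QBDBlocks m₀ m) : Matrix (ℕ × Fin m) (ℕ × Fin m) ℝ≥0∞ :=
  nnNeumann D.Kplus

/-- The top left `m × m` block of `N` (indices here start at `0`). -/
noncomputable def Ncorner (D : QBDBlocks m₀ m) : Matrix (Fin m) (Fin m) ℝ≥0∞ :=
  Matrix.of fun i j => D.N (0, i) (0, j)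

/-- `G₋ = N₁₁ A₋₁`. -/
noncomputable def Gminus (D : QBDBlocks m₀ m) : Matrix (Fin m) (Fin m) ℝ≥0∞ :=
  D.Ncorner * nnCoe D.Aneg

end QBDBlocks

/-! Everything goes through superharmonic functions, `T v ≤ v`. For irreducible `T`, `c_p(T) ≥ 1`
exactly when a positive finite one exists (`one_le_convParam_of_superharmonic`,
`NNIrreducible.exists_superharmonic`), and potentials are minimal: `b + T v ≤ v` forces `∑ T^n b ≤
v` (`tsum_nnNeumann_mul_le`).

If `v` is superharmonic for `K̄`, minimality above level 0 gives `G₋ v₀ ≤ v₁`, hence `(C₀ + A₁G₋) v₀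
≤ v₀` and Perron–Frobenius eigenvalue at most 1. Conversely, an eigenvector of `C₀ + A₁G₋` with
eigenvalue at most 1 extends to the higher levels by `N A₋₁` and is superharmonic for `K̄`.

The set `Γ₊` decides finiteness of `N`. If `A_*(θ) x ≤ x`, then `e^{nθ} x_i` is superharmonic for
`K₊` and bounds the entries of `N` (`N_ne_top`). If `G₋` is finite, it has an eigenvalue `z > 0`,
and `A₋₁ + A₀G₋ + A₁G₋² ≤ G₋` puts `log z` in `Γ₊`.

In the critical case, the level 0 block `M` of the potential of `K̄` satisfies `I + M(C₀ + A₁G₋) ≤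
M`; applied to a fixed vector of `C₀ + A₁G₋` this rules out finite `M`, so `c_p(K̄) ≤ 1`. -/

section NonnegativeMatrices

/-! ### Neumann series, superharmonic functions and the convergence parameter. -/

variable {ι : Type*} [DecidableEq ι]

theorem nnPow_zero (T : Matrix ι ι ℝ≥0∞) : nnPow T 0 = 1 := rfl

theorem nnPow_succ (T : Matrix ι ι ℝ≥0∞) (n : ℕ) (i j : ι) :
    nnPow T (n + 1) i j = ∑' k, nnPow T n i k * T k j := rfl

theorem tsum_one_mul (v : ι → ℝ≥0∞) (i : ι) :
    ∑' k, (1 : Matrix ι ι ℝ≥0∞) i k * v k = v i := by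
  rw [tsum_eq_single i]
  · simp
  · intro k hk
    simp [Matrix.one_apply_ne hk.symm]

theorem tsum_mul_one (v : ι → ℝ≥0∞) (i : ι) :
    ∑' k, v k * (1 : Matrix ι ι ℝ≥0∞) k i = v i := by
  rw [tsum_eq_single i]
  · simp
  · intro k hk
    simp [Matrix.one_apply_ne hk]

theorem nnPow_one (T : Matrix ι ι ℝ≥0∞) (i j : ι) : nnPow T 1 i j = T i j := by
  rw [nnPow_succ, nnPow_zero, tsum_one_mul (fun k => T k j)]

theorem nnPow_succ_left (T : Matrix ι ι ℝ≥0∞) (n : ℕ) (i j : ι) :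
    nnPow T (n + 1) i j = ∑' k, T i k * nnPow T n k j := by
  induction n generalizing j with
  | zero => rw [nnPow_one, nnPow_zero, tsum_mul_one]
  | succ n ih =>
    rw [nnPow_succ]
    simp_rw [ih, nnPow_succ, ← ENNReal.tsum_mul_right, ← ENNReal.tsum_mul_left]
    rw [ENNReal.tsum_comm]
    simp_rw [mul_assoc]

theorem nnPow_transpose (T : Matrix ι ι ℝ≥0∞) (n : ℕ) (i j : ι) :
    nnPow Tᵀ n i j = nnPow T n j i := by
  induction n generalizing j with
  | zero => simp [nnPow_zero, Matrix.one_apply, eq_comm]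
  | succ n ih =>
    rw [nnPow_succ, nnPow_succ_left]
    simp_rw [ih, Matrix.transpose_apply, mul_comm]

theorem nnNeumann_transpose (T : Matrix ι ι ℝ≥0∞) (i j : ι) :
    nnNeumann Tᵀ i j = nnNeumann T j i := by
  simp [nnNeumann, nnPow_transpose]

theorem nnNeumann_apply (T : Matrix ι ι ℝ≥0∞) (i j : ι) :
    nnNeumann T i j = ∑' n, nnPow T n i j := rfl

theorem nnNeumann_eq_left (T : Matrix ι ι ℝ≥0∞) (i j : ι) :
    nnNeumann T i j = (1 : Matrix ι ι ℝ≥0∞) i j + ∑' k, T i k * nnNeumann T k j := by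
  simp_rw [nnNeumann_apply]
  rw [tsum_eq_zero_add' ENNReal.summable, nnPow_zero]
  simp_rw [nnPow_succ_left, ← ENNReal.tsum_mul_left]
  rw [ENNReal.tsum_comm]

theorem nnNeumann_eq_right (T : Matrix ι ι ℝ≥0∞) (i j : ι) :
    nnNeumann T i j = (1 : Matrix ι ι ℝ≥0∞) i j + ∑' k, nnNeumann T i k * T k j := by
  simp_rw [nnNeumann_apply]
  rw [tsum_eq_zero_add' ENNReal.summable, nnPow_zero]
  simp_rw [nnPow_succ, ← ENNReal.tsum_mul_right]
  rw [ENNReal.tsum_comm]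

/-- A superharmonic function dominates the potential of its charge. -/
theorem tsum_nnNeumann_mul_le {T : Matrix ι ι ℝ≥0∞} {b v : ι → ℝ≥0∞}
    (h : ∀ i, b i + ∑' k, T i k * v k ≤ v i) (i : ι) : ∑' k, nnNeumann T i k * b k ≤ v i := by
  -- Partial sums suffice: with `S_N = ∑_{n<N} T^n b`, one has `S_{N+1} = b + T S_N ≤ b + T v ≤ v`.
  have key : ∀ N i, ∑ n ∈ Finset.range N, ∑' k, nnPow T n i k * b k ≤ v i := by
    intro N
    induction N with
    | zero => simp
    | succ N ih =>
      intro i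
      rw [Finset.sum_range_succ', nnPow_zero, tsum_one_mul, add_comm]
      refine le_trans (add_le_add le_rfl ?_) (h i)
      calc ∑ n ∈ Finset.range N, ∑' k, nnPow T (n + 1) i k * b k
          = ∑ n ∈ Finset.range N, ∑' l, T i l * ∑' k, nnPow T n l k * b k := by
            refine Finset.sum_congr rfl fun n _ => ?_
            simp_rw [nnPow_succ_left, ← ENNReal.tsum_mul_left, ← ENNReal.tsum_mul_right]
            rw [ENNReal.tsum_comm]
            simp_rw [mul_assoc]
        _ = ∑' l, T i l * ∑ n ∈ Finset.range N, ∑' k, nnPow T n l k * b k := by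
            simp_rw [Finset.mul_sum]
            rw [Summable.tsum_finsetSum fun _ _ => ENNReal.summable]
        _ ≤ ∑' l, T i l * v l := ENNReal.tsum_le_tsum fun l => by gcongr; exact ih l
  simp_rw [nnNeumann_apply, ← ENNReal.tsum_mul_right]
  rw [ENNReal.tsum_comm, ENNReal.tsum_eq_iSup_nat]
  exact iSup_le fun N => key N i

theorem tsum_mul_nnNeumann_le {T : Matrix ι ι ℝ≥0∞} {b v : ι → ℝ≥0∞}
    (h : ∀ i, b i + ∑' k, v k * T k i ≤ v i) (i : ι) : ∑' k, b k * nnNeumann T k i ≤ v i := by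
  have := tsum_nnNeumann_mul_le (T := Tᵀ) (b := b) (v := v)
    (fun i => by simpa [mul_comm] using h i) i
  simpa [nnNeumann_transpose, mul_comm] using this

theorem tsum_nnPow_mul_le {T : Matrix ι ι ℝ≥0∞} {v : ι → ℝ≥0∞}
    (h : ∀ i, ∑' k, T i k * v k ≤ v i) (n : ℕ) (i : ι) : ∑' k, nnPow T n i k * v k ≤ v i := by
  induction n generalizing i with
  | zero => rw [nnPow_zero, tsum_one_mul]
  | succ n ih =>
    calc ∑' k, nnPow T (n + 1) i k * v k = ∑' l, T i l * ∑' k, nnPow T n l k * v k := by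
          simp_rw [nnPow_succ_left, ← ENNReal.tsum_mul_left, ← ENNReal.tsum_mul_right]
          rw [ENNReal.tsum_comm]
          simp_rw [mul_assoc]
      _ ≤ ∑' l, T i l * v l := ENNReal.tsum_le_tsum fun l => by gcongr; exact ih l
      _ ≤ v i := h i

theorem nnPow_mul_le {T : Matrix ι ι ℝ≥0∞} {v : ι → ℝ≥0∞}
    (h : ∀ i, ∑' k, T i k * v k ≤ v i) (n : ℕ) (i j : ι) : nnPow T n i j * v j ≤ v i :=
  (ENNReal.le_tsum j).trans (tsum_nnPow_mul_le h n i)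

theorem nnPow_mul_nnPow_le (T : Matrix ι ι ℝ≥0∞) (a b : ℕ) (i j k : ι) :
    nnPow T a i j * nnPow T b j k ≤ nnPow T (a + b) i k := by
  induction b generalizing k with
  | zero =>
    rw [nnPow_zero, add_zero]
    by_cases h : j = k
    · subst h; simp
    · simp [Matrix.one_apply_ne h]
  | succ b ih =>
    rw [← add_assoc, nnPow_succ, nnPow_succ, ← ENNReal.tsum_mul_left]
    refine ENNReal.tsum_le_tsum fun l => ?_
    rw [← mul_assoc]
    gcongr
    exact ih l

theorem nnNeumann_mul_nnPow_le (T : Matrix ι ι ℝ≥0∞) (n : ℕ) (i j k : ι) :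
    nnNeumann T i j * nnPow T n j k ≤ nnNeumann T i k := by
  simp_rw [nnNeumann_apply]
  rw [← ENNReal.tsum_mul_right]
  calc ∑' a, nnPow T a i j * nnPow T n j k ≤ ∑' a, nnPow T (a + n) i k :=
        ENNReal.tsum_le_tsum fun a => nnPow_mul_nnPow_le T a n i j k
    _ ≤ ∑' a, nnPow T a i k :=
        ENNReal.tsum_comp_le_tsum_of_injective (add_left_injective n) _

theorem exists_nnPow_pos_of_reflTransGen {T : Matrix ι ι ℝ≥0∞} {i j : ι}
    (h : Relation.ReflTransGen (fun i j => 0 < T i j) i j) : ∃ n, 0 < nnPow T n i j := by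
  induction h with
  | refl => exact ⟨0, by simp [nnPow_zero]⟩
  | @tail b c _ hbc ih =>
    obtain ⟨n, hn⟩ := ih
    refine ⟨n + 1, lt_of_lt_of_le ?_ (nnPow_mul_nnPow_le T n 1 i b c)⟩
    rw [nnPow_one]
    exact ENNReal.mul_pos hn.ne' hbc.ne'

theorem transGen_of_nnPow_pos {T : Matrix ι ι ℝ≥0∞} {n : ℕ} {i j : ι}
    (h : 0 < nnPow T (n + 1) i j) : Relation.TransGen (fun i j => 0 < T i j) i j := by
  induction n generalizing j with
  | zero => rw [nnPow_one] at h; exact .single h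
  | succ n ih =>
    rw [nnPow_succ] at h
    obtain ⟨k, hk⟩ : ∃ k, nnPow T (n + 1) i k * T k j ≠ 0 := by
      by_contra! h0
      simp [h0] at h
    exact (ih (pos_iff_ne_zero.2 (left_ne_zero_of_mul hk))).tail
      (pos_iff_ne_zero.2 (right_ne_zero_of_mul hk))

theorem nnIrreducible_iff {T : Matrix ι ι ℝ≥0∞} :
    NNIrreducible T ↔ ∀ i j, Relation.TransGen (fun i j => 0 < T i j) i j := by
  refine forall₂_congr fun i j => ⟨?_, fun h => ?_⟩
  · rintro ⟨n, hn, h⟩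
    obtain ⟨n, rfl⟩ := Nat.exists_eq_add_of_le' hn
    exact transGen_of_nnPow_pos h
  · obtain ⟨k, hik, hkj⟩ := Relation.TransGen.head'_iff.1 h
    obtain ⟨n, hn⟩ := exists_nnPow_pos_of_reflTransGen hkj
    refine ⟨1 + n, by omega, lt_of_lt_of_le ?_ (nnPow_mul_nnPow_le T 1 n i k j)⟩
    rw [nnPow_one]
    exact ENNReal.mul_pos (ne_of_gt hik) hn.ne'

theorem nnNeumann_pos_of_reflTransGen {T : Matrix ι ι ℝ≥0∞} {i j : ι}
    (h : Relation.ReflTransGen (fun i j => 0 < T i j) i j) : 0 < nnNeumann T i j := by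
  obtain ⟨n, hn⟩ := exists_nnPow_pos_of_reflTransGen h
  exact hn.trans_le (ENNReal.le_tsum n)

theorem NNIrreducible.superharmonic_pos {T : Matrix ι ι ℝ≥0∞} (hT : NNIrreducible T)
    {v : ι → ℝ≥0∞} (h : ∀ i, ∑' k, T i k * v k ≤ v i) {j : ι} (hj : v j ≠ 0) (i : ι) :
    0 < v i := by
  obtain ⟨n, -, hn⟩ := hT i j
  exact (ENNReal.mul_pos hn.ne' hj).trans_le (nnPow_mul_le h n i j)

theorem NNIrreducible.superharmonic_ne_top {T : Matrix ι ι ℝ≥0∞} (hT : NNIrreducible T)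
    {v : ι → ℝ≥0∞} (h : ∀ i, ∑' k, T i k * v k ≤ v i) {i : ι} (hi : v i ≠ ∞) (j : ι) :
    v j ≠ ∞ := by
  obtain ⟨n, -, hn⟩ := hT i j
  intro hj
  have := nnPow_mul_le h n i j
  rw [hj, ENNReal.mul_top hn.ne'] at this
  exact hi (top_le_iff.1 this)

theorem tsum_pow_mul_nnPow_lt_top_of_lt_convParam {T : Matrix ι ι ℝ≥0∞} {u : ℝ≥0}
    (hu : (u : ℝ≥0∞) < convParam T) (i j : ι) :
    ∑' n : ℕ, (u : ℝ≥0∞) ^ n * nnPow T n i j < ∞ := by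
  unfold convParam at hu
  simp only [lt_iSup_iff] at hu
  obtain ⟨w, hw, huw⟩ := hu
  exact lt_of_le_of_lt (ENNReal.tsum_le_tsum fun n => by gcongr) (hw i j)

/-- The bound `(T^n)_{ij} ≤ v_i / v_j` is uniform in `n`, so the series is dominated by a geometric
one for every `u < 1`. -/
theorem one_le_convParam_of_superharmonic {T : Matrix ι ι ℝ≥0∞} {v : ι → ℝ≥0∞}
    (h : ∀ i, ∑' k, T i k * v k ≤ v i) (hpos : ∀ i, 0 < v i) (hfin : ∀ i, v i ≠ ∞) :
    1 ≤ convParam T := by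
  refine le_of_forall_lt fun c hc => ?_
  obtain ⟨u, hcu, hu1⟩ := exists_between hc
  lift u to ℝ≥0 using (hu1.trans ENNReal.one_lt_top).ne
  refine hcu.trans_le (le_iSup₂_of_le u (fun i j => ?_) le_rfl)
  have hle : ∀ n, nnPow T n i j ≤ v i / v j := fun n => by
    rw [ENNReal.le_div_iff_mul_le (Or.inl (hpos j).ne') (Or.inl (hfin j))]
    exact nnPow_mul_le h n i j
  calc ∑' n : ℕ, (u : ℝ≥0∞) ^ n * nnPow T n i j ≤ ∑' n : ℕ, (u : ℝ≥0∞) ^ n * (v i / v j) :=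
        ENNReal.tsum_le_tsum fun n => by gcongr; exact hle n
    _ = (1 - (u : ℝ≥0∞))⁻¹ * (v i / v j) := by
        rw [ENNReal.tsum_mul_right, ENNReal.tsum_geometric]
    _ < ∞ := ENNReal.mul_lt_top
        (ENNReal.inv_lt_top.2 (tsub_pos_of_lt hu1)) (ENNReal.div_lt_top (hfin i) (hpos j).ne')

theorem convParam_le_one_of_nnNeumann_eq_top {T : Matrix ι ι ℝ≥0∞} {i j : ι}
    (h : nnNeumann T i j = ∞) : convParam T ≤ 1 := by
  refine iSup₂_le fun u hu => ?_
  by_contra! h1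
  refine (hu i j).ne (top_le_iff.1 (h.symm.le.trans ?_))
  rw [nnNeumann_apply]
  refine ENNReal.tsum_le_tsum fun n => ?_
  exact le_mul_of_one_le_left zero_le (one_le_pow₀ h1.le)

/-- An irreducible matrix whose convergence parameter is at least `1` has a finite and positive
superharmonic function. -/
theorem NNIrreducible.exists_superharmonic {T : Matrix ι ι ℝ≥0∞} (hT : NNIrreducible T)
    [Nonempty ι] (h1 : 1 ≤ convParam T) :
    ∃ v : ι → ℝ≥0∞, (∀ i, ∑' k, T i k * v k ≤ v i) ∧ (∀ i, 0 < v i) ∧ ∀ i, v i ≠ ∞ := by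
  obtain ⟨o⟩ := ‹Nonempty ι›
  obtain ⟨u, -, hu1, hulim⟩ := exists_seq_strictMono_tendsto' (zero_lt_one (α := ℝ≥0))
  have hfin : ∀ n i j, ∑' k : ℕ, (u n : ℝ≥0∞) ^ k * nnPow T k i j ≠ ∞ := fun n i j =>
    (tsum_pow_mul_nnPow_lt_top_of_lt_convParam (lt_of_lt_of_le (by exact_mod_cast (hu1 n).2) h1) i j).ne
  have hTfin : ∀ i j, T i j ≠ ∞ := by
    intro i j hij
    refine hfin 0 i j (top_le_iff.1 (le_trans ?_ (ENNReal.le_tsum 1)))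
    rw [nnPow_one, hij, ENNReal.mul_top]
    simpa using (hu1 0).1.ne'
  -- Column `o` of the resolvent at `u n < 1`. Normalised to 1 at `o`, it is superharmonic for `u n
  -- * T`; the function sought is a limit as `u n → 1`.
  let g : ℕ → ι → ℝ≥0∞ := fun n i => ∑' k : ℕ, (u n : ℝ≥0∞) ^ k * nnPow T k i o
  have hgo : ∀ n, 1 ≤ g n o := fun n =>
    le_trans (by simp [nnPow_zero]) (ENNReal.le_tsum (f := fun k => (u n : ℝ≥0∞) ^ k * nnPow T k o o) 0)
  have hg : ∀ n i, ∑' k, u n * T i k * g n k ≤ g n i := by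
    intro n i
    simp only [g]
    rw [tsum_eq_zero_add' ENNReal.summable (f := fun k => (u n : ℝ≥0∞) ^ k * nnPow T k i o)]
    refine le_trans (le_of_eq ?_) le_add_self
    simp_rw [nnPow_succ_left, ← ENNReal.tsum_mul_left]
    rw [ENNReal.tsum_comm]
    refine tsum_congr fun a => tsum_congr fun b => ?_
    ring
  let w : ℕ → ι → ℝ≥0∞ := fun n i => g n i * (g n o)⁻¹
  have hw : ∀ n i, ∑' k, u n * T i k * w n k ≤ w n i := by
    intro n i
    simp only [w, ← mul_assoc]
    rw [ENNReal.tsum_mul_right]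
    gcongr
    exact hg n i
  have hwo : ∀ n, w n o = 1 := fun n =>
    ENNReal.mul_inv_cancel (zero_lt_one.trans_le (hgo n)).ne' (hfin n o o)
  -- An ultrafilter limit needs only compactness of `[0, ∞]^ι`; for uncountable `ι` a convergent
  -- subsequence need not exist.
  let U : Ultrafilter ℕ := Ultrafilter.of Filter.atTop
  obtain ⟨v, -, hv⟩ := isCompact_univ.ultrafilter_le_nhds (U.map w) (by simp)
  have hv' : ∀ i, Filter.Tendsto (fun n => w n i) U (nhds (v i)) := by
    have : Filter.Tendsto w U (nhds v) := hv
    exact tendsto_pi_nhds.1 this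
  have huU : Filter.Tendsto (fun n => (u n : ℝ≥0∞)) U (nhds 1) := by
    have : Filter.Tendsto (fun n => (u n : ℝ≥0∞)) Filter.atTop (nhds ((1 : ℝ≥0) : ℝ≥0∞)) :=
      ENNReal.tendsto_coe.2 hulim
    simpa using this.mono_left (Ultrafilter.of_le _)
  have hvo : v o = 1 := tendsto_nhds_unique (hv' o) (by simp [hwo])
  have hvT : ∀ i, ∑' k, T i k * v k ≤ v i := by
    intro i
    -- A Fatou argument: the limit passes through finite sums, where finiteness of `T i k` makes
    -- multiplication continuous.
    rw [ENNReal.tsum_eq_iSup_sum]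
    refine iSup_le fun s => ?_
    have hlim : Filter.Tendsto (fun n => (u n : ℝ≥0∞) * ∑ k ∈ s, T i k * w n k) U
        (nhds (1 * ∑ k ∈ s, T i k * v k)) := by
      refine ENNReal.Tendsto.mul huU (Or.inl one_ne_zero) ?_ (Or.inr ENNReal.one_ne_top)
      exact tendsto_finsetSum s fun k _ => ENNReal.Tendsto.const_mul (hv' k) (Or.inr (hTfin i k))
    rw [one_mul] at hlim
    refine le_of_tendsto_of_tendsto' hlim (hv' i) fun n => ?_
    rw [Finset.mul_sum]
    simp_rw [← mul_assoc]
    exact (ENNReal.sum_le_tsum s).trans (hw n i)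
  exact ⟨v, hvT, hT.superharmonic_pos hvT (j := o) (by simp [hvo]),
    hT.superharmonic_ne_top hvT (i := o) (by simp [hvo])⟩

end NonnegativeMatrices

/-! ### Perron–Frobenius theory for finite matrices. -/

section PerronFrobenius

variable {ι : Type*} [Fintype ι]

/-- Perron–Frobenius for a matrix with positive entries. -/
theorem Matrix.exists_eigenvector_of_pos [Nonempty ι] {T : Matrix ι ι ℝ} (hT : ∀ i j, 0 < T i j)
    {c : ℝ} (hc0 : 0 ≤ c) (hc : ∀ i, c ≤ ∑ j, T i j) :
    ∃ z x, c ≤ z ∧ z ≤ ∑ i, ∑ j, T i j ∧ x ∈ stdSimplex ℝ ι ∧ ∀ i, ∑ j, T i j * x j = z * x i := by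
  classical
  have hbound : ∀ r : ℝ, ∀ x ∈ stdSimplex ℝ ι, (∀ i, r * x i ≤ ∑ j, T i j * x j) →
      r ≤ ∑ i, ∑ j, T i j := by
    intro r x hx h
    calc r = ∑ i, r * x i := by rw [← Finset.mul_sum, hx.2, mul_one]
      _ ≤ ∑ i, ∑ j, T i j * x j := Finset.sum_le_sum fun i _ => h i
      _ ≤ ∑ i, ∑ j, T i j := by
        refine Finset.sum_le_sum fun i _ => Finset.sum_le_sum fun j _ => ?_
        refine mul_le_of_le_one_right (hT i j).le ?_
        rw [← hx.2]
        exact Finset.single_le_sum (fun k _ => hx.1 k) (Finset.mem_univ j)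
  -- Collatz–Wielandt: the eigenvalue is the largest `r` with `r x ≤ T x` for some `x` in the
  -- simplex, attained because `Z` is compact.
  let Z : Set (ℝ × (ι → ℝ)) := (Set.Icc c (∑ i, ∑ j, T i j) ×ˢ stdSimplex ℝ ι) ∩
    {p | ∀ i, p.1 * p.2 i ≤ ∑ j, T i j * p.2 j}
  have hZ : IsCompact Z := by
    refine (isCompact_Icc.prod (isCompact_stdSimplex ℝ ι)).inter_right ?_
    rw [Set.ofPred_forall]
    exact isClosed_iInter fun i => isClosed_le (by fun_prop) (by fun_prop)
  have hmem : ∀ (r : ℝ) (y : ι → ℝ), c ≤ r → (∀ i, 0 < y i) → (∀ i, r * y i ≤ ∑ j, T i j * y j) →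
      ∃ x, (r, x) ∈ Z := by
    intro r y hr hy h
    have hs : 0 < ∑ i, y i := Finset.sum_pos (fun i _ => hy i) Finset.univ_nonempty
    have hx : (fun i => y i / ∑ i, y i) ∈ stdSimplex ℝ ι :=
      ⟨fun i => div_nonneg (hy i).le hs.le, by rw [← Finset.sum_div, div_self hs.ne']⟩
    have hx' : ∀ i, r * (y i / ∑ i, y i) ≤ ∑ j, T i j * (y j / ∑ i, y i) := by
      intro i
      simp_rw [← mul_div_assoc]
      rw [← Finset.sum_div]
      gcongr
      exact h i
    exact ⟨_, ⟨⟨hr, hbound r _ hx hx'⟩, hx⟩, hx'⟩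
  obtain ⟨x₀, hx₀⟩ := hmem c (fun _ => 1) le_rfl (fun _ => one_pos) (by simpa using hc)
  obtain ⟨⟨z, x⟩, hzx, hmax⟩ := hZ.exists_isMaxOn ⟨_, hx₀⟩ continuous_fst.continuousOn
  obtain ⟨⟨⟨hcz, hzB⟩, hx⟩, hle⟩ := hzx
  refine ⟨z, x, hcz, hzB, hx, ?_⟩
  by_contra! hne
  obtain ⟨i₀, hi₀⟩ := hne
  have hle : ∀ i, z * x i ≤ ∑ j, T i j * x j := hle
  have hz0 : 0 ≤ z := hc0.trans hcz
  set y : ι → ℝ := fun i => ∑ j, T i j * x j with hy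
  have hxne : ∃ j, 0 < x j := by
    by_contra! h
    have : ∑ j, x j ≤ 0 := Finset.sum_nonpos fun j _ => h j
    linarith [hx.2]
  obtain ⟨j₀, hj₀⟩ := hxne
  have hypos : ∀ i, 0 < y i := fun i =>
    Finset.sum_pos' (fun j _ => mul_nonneg (hT i j).le (hx.1 j))
      ⟨j₀, Finset.mem_univ _, mul_pos (hT i j₀) hj₀⟩
  -- Since all entries of `T` are positive, one strict inequality in `z x ≤ T x` becomes strict
  -- everywhere for `y = T x`. The least ratio `(T y)_i / y_i` then exceeds the maximal `z`.
  have hstrict : ∀ i, z * y i < ∑ j, T i j * y j := by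
    intro i
    have : z * y i = ∑ j, T i j * (z * x j) := by
      rw [hy, Finset.mul_sum]
      exact Finset.sum_congr rfl fun j _ => by ring
    rw [this]
    refine Finset.sum_lt_sum (fun j _ => mul_le_mul_of_nonneg_left (hle j) (hT i j).le)
      ⟨i₀, Finset.mem_univ _, mul_lt_mul_of_pos_left ?_ (hT i i₀)⟩
    exact lt_of_le_of_ne (hle i₀) hi₀.symm
  obtain ⟨i₁, -, hi₁⟩ := Finset.exists_min_image Finset.univ
    (fun i => (∑ j, T i j * y j) / y i) Finset.univ_nonempty
  have hzr : z < (∑ j, T i₁ j * y j) / y i₁ := (lt_div_iff₀ (hypos i₁)).2 (hstrict i₁)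
  obtain ⟨x', hx'⟩ := hmem _ y (hcz.trans hzr.le) hypos
    fun i => (le_div_iff₀ (hypos i)).1 (hi₁ i (Finset.mem_univ i))
  exact absurd (hmax hx') (not_le.2 hzr)

/-- Perron–Frobenius for a nonnegative matrix, with a lower bound on the eigenvalue. -/
theorem Matrix.exists_eigenvector_of_nonneg [Nonempty ι] {T : Matrix ι ι ℝ}
    (hT : ∀ i j, 0 ≤ T i j) {c : ℝ} (hc0 : 0 ≤ c) (hc : ∀ i, c ≤ ∑ j, T i j) :
    ∃ z x, c ≤ z ∧ x ∈ stdSimplex ℝ ι ∧ ∀ i, ∑ j, T i j * x j = z * x i := by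
  -- Perturb to positive entries and let `ε → 0`; as `ε ≤ 1`, all eigenpairs stay in one compact
  -- set.
  let ε : ℕ → ℝ := fun n => 1 / ((n : ℝ) + 1)
  have hε : ∀ n, 0 < ε n := fun n => Nat.one_div_pos_of_nat
  have hε1 : ∀ n, ε n ≤ 1 := fun n => by
    simp only [ε]
    rw [div_le_one (by positivity)]
    linarith [(Nat.cast_nonneg n : (0 : ℝ) ≤ n)]
  have hex : ∀ n, ∃ p : ℝ × (ι → ℝ),
      p ∈ Set.Icc c (∑ i, ∑ j, (T i j + 1)) ×ˢ stdSimplex ℝ ι ∧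
      ∀ i, ∑ j, (T i j + ε n) * p.2 j = p.1 * p.2 i := by
    intro n
    obtain ⟨z, x, h1, h2, h3, h4⟩ := Matrix.exists_eigenvector_of_pos
      (T := Matrix.of fun i j => T i j + ε n) (fun i j => add_pos_of_nonneg_of_pos (hT i j) (hε n))
      hc0 (fun i => (hc i).trans (Finset.sum_le_sum fun j _ => by
        simpa using (hε n).le))
    refine ⟨(z, x), ⟨⟨h1, h2.trans ?_⟩, h3⟩, h4⟩
    exact Finset.sum_le_sum fun i _ => Finset.sum_le_sum fun j _ => by
      simpa using hε1 n
  choose p hp hpe using hex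
  obtain ⟨⟨z, x⟩, hzx, φ, hφ, hlim⟩ :=
    (isCompact_Icc.prod (isCompact_stdSimplex ℝ ι)).tendsto_subseq hp
  refine ⟨z, x, hzx.1.1, hzx.2, fun i => ?_⟩
  have hl1 : Filter.Tendsto (fun n => (p (φ n)).1) Filter.atTop (nhds z) :=
    (continuous_fst.tendsto _).comp hlim
  have hl2 : ∀ j, Filter.Tendsto (fun n => (p (φ n)).2 j) Filter.atTop (nhds (x j)) := fun j =>
    (((continuous_apply j).comp continuous_snd).tendsto _).comp hlim
  have hle : Filter.Tendsto (fun n => ε (φ n)) Filter.atTop (nhds 0) :=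
    tendsto_one_div_add_atTop_nhds_zero_nat.comp hφ.tendsto_atTop
  have hL : Filter.Tendsto (fun n => ∑ j, (T i j + ε (φ n)) * (p (φ n)).2 j) Filter.atTop
      (nhds (∑ j, (T i j + 0) * x j)) :=
    tendsto_finsetSum _ fun j _ => (tendsto_const_nhds.add hle).mul (hl2 j)
  simp only [add_zero] at hL
  refine tendsto_nhds_unique hL ?_
  simp_rw [hpe]
  exact hl1.mul (hl2 i)

/-- The lower bound `c` serves `G₋`: it makes the eigenvalue positive, so that its logarithm is
available. -/
theorem exists_nonneg_eigenvector [Nonempty ι] {T : Matrix ι ι ℝ≥0∞} (hT : ∀ i j, T i j ≠ ∞)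
    {c : ℝ≥0} (hc : ∀ i, (c : ℝ≥0∞) ≤ ∑ j, T i j) :
    ∃ (z : ℝ≥0) (x : ι → ℝ≥0), c ≤ z ∧ x ≠ 0 ∧ ∀ i, ∑ j, T i j * (x j : ℝ≥0∞) = z * x i := by
  obtain ⟨z, x, hcz, hx, he⟩ := Matrix.exists_eigenvector_of_nonneg
    (T := Matrix.of fun i j => (T i j).toReal) (fun i j => ENNReal.toReal_nonneg) c.coe_nonneg
    (fun i => by
      simp only [Matrix.of_apply]
      rw [← ENNReal.toReal_sum fun j _ => hT i j]
      exact ENNReal.toReal_mono (ENNReal.sum_ne_top.2 fun j _ => hT i j) (hc i))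
  lift z to ℝ≥0 using c.coe_nonneg.trans hcz
  lift x to ι → ℝ≥0 using hx.1
  refine ⟨z, x, by exact_mod_cast hcz, ?_, fun i => ?_⟩
  · rintro rfl
    simpa using hx.2
  · refine (ENNReal.toReal_eq_toReal_iff' ?_ (by finiteness)).1 ?_
    · exact ENNReal.sum_ne_top.2 fun j _ => ENNReal.mul_ne_top (hT i j) ENNReal.coe_ne_top
    · rw [ENNReal.toReal_sum fun j _ => ENNReal.mul_ne_top (hT i j) ENNReal.coe_ne_top]
      simpa using he i

/-- Scale `v` until it touches `x` from above and compare at a point of contact, where `l x_i ≤ a (T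
v)_i ≤ r x_i`. -/
theorem eigenvalue_le_of_superharmonic {T : Matrix ι ι ℝ≥0∞} {v : ι → ℝ≥0∞} {r : ℝ≥0∞}
    (hv : ∀ i, ∑ j, T i j * v j ≤ r * v i) (hpos : ∀ i, 0 < v i) (hfin : ∀ i, v i ≠ ∞)
    {l : ℝ≥0} {x : ι → ℝ≥0} (hx : x ≠ 0) (hl : ∀ i, ∑ j, T i j * (x j : ℝ≥0∞) = l * x i) :
    (l : ℝ≥0∞) ≤ r := by
  obtain ⟨k, hk⟩ := Function.ne_iff.1 hx
  obtain ⟨i, -, hi⟩ := Finset.exists_max_image Finset.univ (fun i => (x i : ℝ≥0∞) / v i)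
    ⟨k, Finset.mem_univ k⟩
  set a : ℝ≥0∞ := x i / v i with ha
  have hxa : ∀ j, (x j : ℝ≥0∞) ≤ a * v j := fun j =>
    (ENNReal.div_le_iff (hpos j).ne' (hfin j)).1 (hi j (Finset.mem_univ j))
  have hxi : (x i : ℝ≥0∞) = a * v i := (ENNReal.div_mul_cancel (hpos i).ne' (hfin i)).symm
  have hxi0 : (x i : ℝ≥0∞) ≠ 0 := by
    intro h0
    have : (x k : ℝ≥0∞) ≤ 0 := by simpa [ha, h0] using hxa k
    exact hk (by simpa using this)
  have : (l : ℝ≥0∞) * x i ≤ r * x i := by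
    calc (l : ℝ≥0∞) * x i = ∑ j, T i j * (x j : ℝ≥0∞) := (hl i).symm
      _ ≤ ∑ j, T i j * (a * v j) := Finset.sum_le_sum fun j _ => by gcongr; exact hxa j
      _ = a * ∑ j, T i j * v j := by
        rw [Finset.mul_sum]; exact Finset.sum_congr rfl fun j _ => by ring
      _ ≤ a * (r * v i) := by gcongr; exact hv i
      _ = r * x i := by rw [hxi]; ring
  exact (ENNReal.mul_le_mul_iff_left hxi0 ENNReal.coe_ne_top).1 this

theorem pfEigenvalue_le_of_superharmonic {T : Matrix ι ι ℝ≥0∞} {v : ι → ℝ≥0∞} {r : ℝ≥0∞}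
    (hr : r ≠ ∞) (hv : ∀ i, ∑ j, T i j * v j ≤ r * v i) (hpos : ∀ i, 0 < v i)
    (hfin : ∀ i, v i ≠ ∞) : pfEigenvalue T ≤ r := by
  have hT : ∀ i j, T i j ≠ ∞ := by
    intro i j hij
    have h : T i j * v j ≤ r * v i :=
      (Finset.single_le_sum (f := fun j => T i j * v j) (fun _ _ => zero_le)
        (Finset.mem_univ j)).trans (hv i)
    rw [hij, ENNReal.top_mul (hpos j).ne'] at h
    exact ENNReal.mul_ne_top hr (hfin i) (top_le_iff.1 h)
  unfold pfEigenvalue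
  rw [if_pos hT]
  refine iSup₂_le ?_
  rintro l ⟨x, hx, hl⟩
  exact eigenvalue_le_of_superharmonic hv hpos hfin hx hl

theorem ne_top_of_pfEigenvalue_ne_top {T : Matrix ι ι ℝ≥0∞} (h : pfEigenvalue T ≠ ∞) (i j : ι) :
    T i j ≠ ∞ := by
  by_contra hij
  refine h (if_neg fun h' => h' i j hij)

theorem le_pfEigenvalue {T : Matrix ι ι ℝ≥0∞} (hT : ∀ i j, T i j ≠ ∞) {l : ℝ≥0} {x : ι → ℝ≥0}
    (hx : x ≠ 0) (hl : ∀ i, ∑ j, T i j * (x j : ℝ≥0∞) = l * x i) : (l : ℝ≥0∞) ≤ pfEigenvalue T := by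
  unfold pfEigenvalue
  rw [if_pos hT]
  exact le_iSup₂_of_le l ⟨x, hx, hl⟩ le_rfl

end PerronFrobenius


/-! ### Sums over levels. -/

section LevelSums

variable {m : ℕ}

theorem tsum_level_split (f : ℕ × Fin m → ℝ≥0∞) :
    ∑' q, f q = ∑ j, f (0, j) + ∑' q : ℕ × Fin m, f (q.1 + 1, q.2) := by
  rw [ENNReal.tsum_prod' (f := f), tsum_eq_zero_add' ENNReal.summable, tsum_fintype,
    ENNReal.tsum_prod' (f := fun q : ℕ × Fin m => f (q.1 + 1, q.2))]

theorem tsum_level_zero_mul (a : Fin m → ℝ≥0∞) (v : ℕ × Fin m → ℝ≥0∞) :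
    ∑' q : ℕ × Fin m, (if q.1 = 0 then a q.2 else 0) * v q = ∑ j, a j * v (0, j) := by
  simp [tsum_level_split]

theorem tsum_mul_level_zero (a : Fin m → ℝ≥0∞) (v : ℕ × Fin m → ℝ≥0∞) :
    ∑' q : ℕ × Fin m, v q * (if q.1 = 0 then a q.2 else 0) = ∑ j, v (0, j) * a j := by
  simp [tsum_level_split]

end LevelSums

/-! ### Block rows of `K₊` and of the canonical form. -/

namespace QBDBlocks

variable {m₀ m : ℕ} (D : QBDBlocks m₀ m)

theorem Kplus_zero_zero (i j : Fin m) : D.Kplus (0, i) (0, j) = D.Azero i j := by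
  simp [Kplus]

theorem Kplus_zero_succ (i : Fin m) (n : ℕ) (j : Fin m) :
    D.Kplus (0, i) (n + 1, j) = if n = 0 then (D.Apos i j : ℝ≥0∞) else 0 := by
  simp [Kplus]

theorem Kplus_succ_zero (n : ℕ) (i j : Fin m) :
    D.Kplus (n + 1, i) (0, j) = if n = 0 then (D.Aneg i j : ℝ≥0∞) else 0 := by
  simp [Kplus]

theorem Kplus_succ_succ (n : ℕ) (i : Fin m) (k : ℕ) (j : Fin m) :
    D.Kplus (n + 1, i) (k + 1, j) = D.Kplus (n, i) (k, j) := by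
  simp [Kplus]

theorem Kbar_zero_zero (i j : Fin m) : D.Kbar (0, i) (0, j) = D.Czero i j := by
  simp [Kbar]

theorem Kbar_zero_succ (i : Fin m) (n : ℕ) (j : Fin m) :
    D.Kbar (0, i) (n + 1, j) = if n = 0 then (D.Apos i j : ℝ≥0∞) else 0 := by
  simp [Kbar, Kplus_zero_succ]

theorem Kbar_succ_zero (n : ℕ) (i j : Fin m) :
    D.Kbar (n + 1, i) (0, j) = if n = 0 then (D.Aneg i j : ℝ≥0∞) else 0 := by
  simp [Kbar, Kplus_succ_zero]

theorem Kbar_succ_succ (n : ℕ) (i : Fin m) (k : ℕ) (j : Fin m) :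
    D.Kbar (n + 1, i) (k + 1, j) = D.Kplus (n, i) (k, j) := by
  simp [Kbar, Kplus_succ_succ]

theorem tsum_Kplus_zero (i : Fin m) (v : ℕ × Fin m → ℝ≥0∞) :
    ∑' q, D.Kplus (0, i) q * v q
      = ∑ j, D.Azero i j * v (0, j) + ∑ j, D.Apos i j * v (1, j) := by
  rw [tsum_level_split]
  simp only [Kplus_zero_zero, Kplus_zero_succ]
  rw [tsum_level_zero_mul (fun j => (D.Apos i j : ℝ≥0∞)) fun q => v (q.1 + 1, q.2)]

theorem tsum_Kplus_succ (n : ℕ) (i : Fin m) (v : ℕ × Fin m → ℝ≥0∞) :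
    ∑' q, D.Kplus (n + 1, i) q * v q
      = (if n = 0 then ∑ j, D.Aneg i j * v (0, j) else 0)
        + ∑' q, D.Kplus (n, i) q * v (q.1 + 1, q.2) := by
  rw [tsum_level_split]
  simp only [Kplus_succ_zero, Kplus_succ_succ]
  split_ifs <;> simp

theorem tsum_Kplus_succ_eq_sum (n : ℕ) (i : Fin m) (v : ℕ × Fin m → ℝ≥0∞) :
    ∑' q, D.Kplus (n + 1, i) q * v q
      = ∑ j, D.Aneg i j * v (n, j) + (∑ j, D.Azero i j * v (n + 1, j)
        + ∑ j, D.Apos i j * v (n + 2, j)) := by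
  induction n generalizing v with
  | zero => rw [tsum_Kplus_succ, if_pos rfl, tsum_Kplus_zero]
  | succ n ih =>
    rw [tsum_Kplus_succ, if_neg (Nat.succ_ne_zero n), zero_add, ih]

theorem tsum_Kbar_zero (i : Fin m) (v : ℕ × Fin m → ℝ≥0∞) :
    ∑' q, D.Kbar (0, i) q * v q
      = ∑ j, D.Czero i j * v (0, j) + ∑ j, D.Apos i j * v (1, j) := by
  rw [tsum_level_split]
  simp only [Kbar_zero_zero, Kbar_zero_succ]
  rw [tsum_level_zero_mul (fun j => (D.Apos i j : ℝ≥0∞)) fun q => v (q.1 + 1, q.2)]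

/-- Seen from level 1 upwards, `K̄` is `K₊` acting on the shifted function, with level 0 entering
only as the charge `A₋₁ v₀`. -/
theorem tsum_Kbar_succ (n : ℕ) (i : Fin m) (v : ℕ × Fin m → ℝ≥0∞) :
    ∑' q, D.Kbar (n + 1, i) q * v q
      = (if n = 0 then ∑ j, D.Aneg i j * v (0, j) else 0)
        + ∑' q, D.Kplus (n, i) q * v (q.1 + 1, q.2) := by
  rw [tsum_level_split]
  simp only [Kbar_succ_zero, Kbar_succ_succ]
  split_ifs <;> simp

/-! ### Superharmonic functions above level `0` -/

theorem Gminus_apply (i j : Fin m) :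
    D.Gminus i j = ∑ k, D.N (0, i) (0, k) * D.Aneg k j := rfl

theorem sum_Gminus_mul (i : Fin m) (x : Fin m → ℝ≥0∞) :
    ∑ j, D.Gminus i j * x j = ∑ k, D.N (0, i) (0, k) * ∑ j, D.Aneg k j * x j := by
  simp_rw [Gminus_apply, Finset.mul_sum, Finset.sum_mul]
  rw [Finset.sum_comm]
  simp_rw [mul_assoc]

theorem sum_canonical_mul (i : Fin m) (x : Fin m → ℝ≥0∞) :
    ∑ j, (D.Czero + nnCoe D.Apos * D.Gminus) i j * x j
      = ∑ j, D.Czero i j * x j + ∑ j, D.Apos i j * ∑ k, D.Gminus j k * x k := by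
  have := congrFun (Matrix.add_mulVec D.Czero (nnCoe D.Apos * D.Gminus) x) i
  rw [← Matrix.mulVec_mulVec] at this
  exact this

/-- Minimality of the `K₊`-potential of the charge `A₋₁ v₀`, read on its lowest level. Not
mentioning `K̄` in the hypothesis lets it also be applied to functions shifted up by a level. -/
theorem sum_Gminus_mul_le {v : ℕ × Fin m → ℝ≥0∞}
    (h : ∀ n i, (if n = 0 then ∑ j, D.Aneg i j * v (0, j) else 0)
        + ∑' q, D.Kplus (n, i) q * v (q.1 + 1, q.2) ≤ v (n + 1, i)) (i : Fin m) :
    ∑ j, D.Gminus i j * v (0, j) ≤ v (1, i) := by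
  have := tsum_nnNeumann_mul_le (T := D.Kplus)
    (b := fun q => if q.1 = 0 then ∑ j, D.Aneg q.2 j * v (0, j) else 0)
    (v := fun q => v (q.1 + 1, q.2)) (fun q => h q.1 q.2) (0, i)
  rw [tsum_mul_level_zero (fun k => ∑ j, D.Aneg k j * v (0, j))] at this
  rw [sum_Gminus_mul]
  exact this

theorem sum_canonical_mul_le {v : ℕ × Fin m → ℝ≥0∞} (hv : ∀ p, ∑' q, D.Kbar p q * v q ≤ v p)
    (i : Fin m) :
    ∑ j, (D.Czero + nnCoe D.Apos * D.Gminus) i j * v (0, j) ≤ v (0, i) := by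
  rw [sum_canonical_mul D i fun j => v (0, j)]
  refine le_trans ?_ (hv (0, i))
  rw [tsum_Kbar_zero]
  gcongr with j
  exact D.sum_Gminus_mul_le (fun n i => (D.tsum_Kbar_succ n i v).symm.le.trans (hv (n + 1, i))) j

/-- The minimal extension of a function on level `0` which is harmonic on the higher levels. -/
noncomputable def harmonicExtension (x : Fin m → ℝ≥0∞) : ℕ × Fin m → ℝ≥0∞
  | (0, i) => x i
  | (n + 1, i) => ∑ k, D.N (n, i) (0, k) * ∑ j, D.Aneg k j * x j

theorem harmonicExtension_zero (x : Fin m → ℝ≥0∞) (i : Fin m) :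
    D.harmonicExtension x (0, i) = x i := rfl

theorem harmonicExtension_succ (x : Fin m → ℝ≥0∞) (n : ℕ) (i : Fin m) :
    D.harmonicExtension x (n + 1, i) = ∑ k, D.N (n, i) (0, k) * ∑ j, D.Aneg k j * x j := rfl

theorem harmonicExtension_one (x : Fin m → ℝ≥0∞) (i : Fin m) :
    D.harmonicExtension x (1, i) = ∑ j, D.Gminus i j * x j := by
  rw [sum_Gminus_mul]
  rfl

/-- This is `N = I + K₊ N` applied to the charge `A₋₁ x`. -/
theorem harmonicExtension_succ_eq (x : Fin m → ℝ≥0∞) (n : ℕ) (i : Fin m) :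
    D.harmonicExtension x (n + 1, i) = (if n = 0 then ∑ j, D.Aneg i j * x j else 0)
      + ∑' q, D.Kplus (n, i) q * D.harmonicExtension x (q.1 + 1, q.2) := by
  have h1 : ∀ k, D.N (n, i) (0, k)
      = (if n = 0 ∧ i = k then 1 else 0) + ∑' q, D.Kplus (n, i) q * D.N q (0, k) := by
    intro k
    rw [N, nnNeumann_eq_left]
    simp [Matrix.one_apply]
  rw [harmonicExtension_succ]
  simp_rw [h1, add_mul, Finset.sum_add_distrib, harmonicExtension_succ]
  congr 1
  · by_cases hn : n = 0 <;> simp [hn]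
  · have h2 : ∀ c : Fin m → ℝ≥0∞, ∑ k, (∑' q, D.Kplus (n, i) q * D.N q (0, k)) * c k
        = ∑' q, D.Kplus (n, i) q * ∑ k, D.N q (0, k) * c k := by
      intro c
      simp_rw [Finset.mul_sum]
      rw [Summable.tsum_finsetSum fun _ _ => ENNReal.summable]
      simp_rw [← ENNReal.tsum_mul_right, mul_assoc]
    exact h2 fun k => ∑ j, D.Aneg k j * x j

theorem harmonicExtension_ne_top {x : Fin m → ℝ≥0∞} (hN : ∀ p q, D.N p q ≠ ∞)
    (hx : ∀ i, x i ≠ ∞) (p : ℕ × Fin m) : D.harmonicExtension x p ≠ ∞ := by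
  obtain ⟨_ | n, i⟩ := p
  · exact hx i
  · exact ENNReal.sum_ne_top.2 fun k _ => ENNReal.mul_ne_top (hN _ _)
      (ENNReal.sum_ne_top.2 fun j _ => ENNReal.mul_ne_top ENNReal.coe_ne_top (hx j))

theorem harmonicExtension_superharmonic {x : Fin m → ℝ≥0∞}
    (hx : ∀ i, ∑ j, (D.Czero + nnCoe D.Apos * D.Gminus) i j * x j ≤ x i) (p : ℕ × Fin m) :
    ∑' q, D.Kbar p q * D.harmonicExtension x q ≤ D.harmonicExtension x p := by
  obtain ⟨_ | n, i⟩ := p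
  · rw [tsum_Kbar_zero]
    simp_rw [harmonicExtension_one, harmonicExtension_zero]
    rw [← sum_canonical_mul]
    exact hx i
  · rw [tsum_Kbar_succ, harmonicExtension_succ_eq]
    rfl

/-- `A₋₁ + A₀ G₋ + A₁ G₋² ≤ G₋`, applied to a vector. -/
theorem sum_Gminus_quadratic_le (x : Fin m → ℝ≥0∞) (i : Fin m) :
    ∑ j, D.Aneg i j * x j + (∑ j, D.Azero i j * ∑ k, D.Gminus j k * x k
        + ∑ j, D.Apos i j * ∑ k, D.Gminus j k * ∑ l, D.Gminus k l * x l)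
      ≤ ∑ j, D.Gminus i j * x j := by
  rw [← harmonicExtension_one, harmonicExtension_succ_eq, if_pos rfl, tsum_Kplus_zero]
  simp_rw [← harmonicExtension_one D x]
  gcongr with j
  -- The extension shifted up by one level has level 1 as its new boundary, so minimality bounds
  -- `G₋` of level 1 by level 2.
  refine D.sum_Gminus_mul_le (v := fun q => D.harmonicExtension x (q.1 + 1, q.2)) (fun n i => ?_) j
  rw [harmonicExtension_succ_eq D x (n + 1) i, if_neg (Nat.succ_ne_zero n), zero_add,
    tsum_Kplus_succ]

/-! ### Consequences of irreducibility -/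

/-- A path into the boundary can enter it only from the lowest level of `K₊`; cut the path at its
first entry. -/
theorem exists_reach_levelZero {x : Fin m₀ ⊕ (ℕ × Fin m)} {a : Fin m₀}
    (h : Relation.TransGen (fun x y => 0 < D.K x y) x (.inl a)) (p : ℕ × Fin m)
    (hp : x = .inr p) :
    ∃ i, Relation.ReflTransGen (fun p q => 0 < D.Kplus p q) p (0, i) := by
  induction h using Relation.TransGen.head_induction_on generalizing p with
  | single h1 =>
    subst hp
    obtain ⟨n, i⟩ := p
    obtain rfl : n = 0 := by
      by_contra hn
      simp [K, hn] at h1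
    exact ⟨i, .refl⟩
  | @head x y h1 _ ih =>
    subst hp
    obtain b | q := y
    · obtain ⟨n, i⟩ := p
      obtain rfl : n = 0 := by
        by_contra hn
        simp [K, hn] at h1
      exact ⟨i, .refl⟩
    · obtain ⟨i, hi⟩ := ih q rfl
      exact ⟨i, .head (by simpa [K] using h1) hi⟩

/-- Stop the path just before its first visit to level 0. By homogeneity that piece can be shifted
down one level, and the step cut off is an entry of `A₋₁`. -/
theorem exists_reach_descent {p : ℕ × Fin m} {i : Fin m}
    (h : Relation.ReflTransGen (fun p q => 0 < D.Kplus p q) p (0, i)) (n : ℕ) (j : Fin m)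
    (hp : p = (n + 1, j)) :
    ∃ i l, Relation.ReflTransGen (fun p q => 0 < D.Kplus p q) (n, j) (0, i) ∧ 0 < D.Aneg i l := by
  induction h using Relation.ReflTransGen.head_induction_on generalizing n j with
  | refl => simp at hp
  | @head p q h1 _ ih =>
    subst hp
    obtain ⟨_ | k, l⟩ := q
    · rw [Kplus_succ_zero] at h1
      split_ifs at h1 with hn
      · subst hn
        exact ⟨j, l, .refl, by simpa using h1⟩
      · simp at h1
    · obtain ⟨i, l', h2, h3⟩ := ih k l rfl
      rw [Kplus_succ_succ] at h1
      exact ⟨i, l', .head h1 h2, h3⟩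

variable {D}

theorem exists_reach_Aneg (hm₀ : 0 < m₀) (hK : NNIrreducible D.K) (n : ℕ) (j : Fin m) :
    ∃ i l, Relation.ReflTransGen (fun p q => 0 < D.Kplus p q) (n, j) (0, i) ∧ 0 < D.Aneg i l := by
  obtain ⟨i, hi⟩ := D.exists_reach_levelZero
    (nnIrreducible_iff.1 hK (.inr (n + 1, j)) (.inl ⟨0, hm₀⟩)) _ rfl
  exact D.exists_reach_descent hi n j rfl

theorem Kplus_le_Kbar (p q : ℕ × Fin m) : D.Kplus p q ≤ D.Kbar p q := by
  obtain ⟨_ | n, i⟩ := p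
  · obtain ⟨_ | k, j⟩ := q
    · rw [Kplus_zero_zero, Kbar_zero_zero]
      exact le_add_self
    · rw [Kplus_zero_succ, Kbar_zero_succ]
  · simp [Kbar]

theorem Czero_pos {i c : Fin m} {a b : Fin m₀} (hia : 0 < D.Bneg i a)
    (hab : Relation.ReflTransGen (fun a b => 0 < nnCoe D.Bzero a b) a b) (hbc : 0 < D.Bpos b c) :
    0 < D.Czero i c := by
  have h1 : 0 < (nnCoe D.Bneg * nnNeumann (nnCoe D.Bzero)) i b := by
    refine lt_of_lt_of_le (ENNReal.mul_pos ?_ (nnNeumann_pos_of_reflTransGen hab).ne')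
      (Finset.single_le_sum (f := fun a => nnCoe D.Bneg i a * nnNeumann (nnCoe D.Bzero) a b)
        (fun _ _ => zero_le) (Finset.mem_univ a))
    simpa [nnCoe] using hia.ne'
  have h2 : 0 < (nnCoe D.Bneg * nnNeumann (nnCoe D.Bzero) * nnCoe D.Bpos) i c := by
    refine lt_of_lt_of_le (ENNReal.mul_pos h1.ne' ?_)
      (Finset.single_le_sum
        (f := fun b => (nnCoe D.Bneg * nnNeumann (nnCoe D.Bzero)) i b * nnCoe D.Bpos b c)
        (fun _ _ => zero_le) (Finset.mem_univ b))
    simpa [nnCoe] using hbc.ne'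
  exact h2.trans_le le_self_add

/-- Each excursion into the boundary is replaced by a single `C₀` step. The second conjunct carries
the induction through paths that start inside the boundary. -/
theorem reach_Kbar_of_reach_K {x : Fin m₀ ⊕ (ℕ × Fin m)} {q : ℕ × Fin m}
    (h : Relation.TransGen (fun x y => 0 < D.K x y) x (.inr q)) :
    (∀ p, x = .inr p → Relation.TransGen (fun p q => 0 < D.Kbar p q) p q) ∧
    (∀ a, x = .inl a → ∃ b c, Relation.ReflTransGen (fun a b => 0 < nnCoe D.Bzero a b) a b ∧
      0 < D.Bpos b c ∧ Relation.ReflTransGen (fun p q => 0 < D.Kbar p q) (0, c) q) := by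
  have hB : ∀ {b : Fin m₀} {p : ℕ × Fin m}, 0 < D.K (.inl b) (.inr p) →
      p.1 = 0 ∧ 0 < D.Bpos b p.2 := by
    intro b p hbp
    by_cases hp : p.1 = 0 <;> simp [K, hp] at hbp
    exact ⟨hp, hbp⟩
  have hC : ∀ {p : ℕ × Fin m} {b : Fin m₀}, 0 < D.K (.inr p) (.inl b) →
      p.1 = 0 ∧ 0 < D.Bneg p.2 b := by
    intro p b hbp
    by_cases hp : p.1 = 0 <;> simp [K, hp] at hbp
    exact ⟨hp, hbp⟩
  induction h using Relation.TransGen.head_induction_on with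
  | @single x h1 =>
    refine ⟨?_, ?_⟩
    · rintro p rfl
      exact .single (lt_of_lt_of_le (by simpa [K] using h1) (Kplus_le_Kbar p q))
    · rintro a rfl
      obtain ⟨n, c⟩ := q
      obtain ⟨rfl, h2⟩ := hB h1
      exact ⟨a, c, .refl, h2, .refl⟩
  | @head x y h1 _ ih =>
    refine ⟨?_, ?_⟩
    · rintro p rfl
      obtain a | p' := y
      · obtain ⟨b, c, hab, hbc, hcq⟩ := ih.2 a rfl
        obtain ⟨n, i⟩ := p
        obtain ⟨rfl, h2⟩ := hC h1
        refine Relation.TransGen.head' ?_ hcq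
        rw [Kbar_zero_zero]
        exact Czero_pos h2 hab hbc
      · exact .head (lt_of_lt_of_le (by simpa [K] using h1) (Kplus_le_Kbar p p')) (ih.1 p' rfl)
    · rintro a rfl
      obtain a' | ⟨n, c⟩ := y
      · obtain ⟨b, c, hab, hbc, hcq⟩ := ih.2 a' rfl
        exact ⟨b, c, .head (by simpa [K] using h1) hab, hbc, hcq⟩
      · obtain ⟨rfl, h2⟩ := hB h1
        exact ⟨a, c, .refl, h2, (ih.1 _ rfl).to_reflTransGen⟩

theorem Kbar_irreducible (hK : NNIrreducible D.K) : NNIrreducible D.Kbar :=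
  nnIrreducible_iff.2 fun p q =>
    (reach_Kbar_of_reach_K (nnIrreducible_iff.1 hK (.inr p) (.inr q))).1 p rfl

/-! ### The matrices `A_*(θ)` and finiteness of `N` and `G₋`. -/

theorem Astar_apply (θ : ℝ) (i j : Fin m) :
    D.Astar θ i j = ENNReal.ofReal (Real.exp (-θ)) * D.Aneg i j + D.Azero i j
      + ENNReal.ofReal (Real.exp θ) * D.Apos i j := rfl

theorem Astar_pos_iff (θ : ℝ) (i j : Fin m) :
    0 < D.Astar θ i j ↔ 0 < D.Aneg i j ∨ 0 < D.Azero i j ∨ 0 < D.Apos i j := by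
  have := (Real.exp_pos (-θ)).not_ge
  simp [Astar_apply, pos_iff_ne_zero, Real.exp_pos, this]
  tauto

/-- The zero pattern of `A_*(θ)` does not depend on `θ`. -/
theorem Astar_irreducible (hA : NNIrreducible (D.Astar 0)) (θ : ℝ) :
    NNIrreducible (D.Astar θ) := by
  rw [nnIrreducible_iff] at hA ⊢
  simpa only [Astar_pos_iff] using hA

theorem Astar_ne_top (θ : ℝ) (i j : Fin m) : D.Astar θ i j ≠ ∞ := by
  rw [Astar_apply]
  finiteness

theorem sum_Astar_mul (θ : ℝ) (i : Fin m) (x : Fin m → ℝ≥0∞) :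
    ∑ j, D.Astar θ i j * x j = ENNReal.ofReal (Real.exp (-θ)) * ∑ j, D.Aneg i j * x j
      + (∑ j, D.Azero i j * x j + ENNReal.ofReal (Real.exp θ) * ∑ j, D.Apos i j * x j) := by
  simp_rw [Astar_apply, add_mul, Finset.sum_add_distrib, Finset.mul_sum, mul_assoc, add_assoc]

theorem mem_GammaPlus_of_superharmonic (hA : NNIrreducible (D.Astar 0)) {θ : ℝ}
    {x : Fin m → ℝ≥0} (hx : x ≠ 0)
    (h : ∀ i, ∑ j, D.Astar θ i j * (x j : ℝ≥0∞) ≤ x i) : θ ∈ D.GammaPlus := by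
  obtain ⟨k, hk⟩ := Function.ne_iff.1 hx
  refine pfEigenvalue_le_of_superharmonic (v := fun i => (x i : ℝ≥0∞)) ENNReal.one_ne_top
    (fun i => by simpa using h i) ?_ (fun i => ENNReal.coe_ne_top)
  exact (Astar_irreducible hA θ).superharmonic_pos (fun i => by simpa using h i) (j := k)
    (by simpa using hk)

theorem exists_superharmonic_of_mem_GammaPlus (hm : 0 < m) (hA : NNIrreducible (D.Astar 0))
    {θ : ℝ} (hθ : θ ∈ D.GammaPlus) :
    ∃ x : Fin m → ℝ≥0, (∀ i, 0 < x i) ∧ ∀ i, ∑ j, D.Astar θ i j * (x j : ℝ≥0∞) ≤ x i := by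
  have : Nonempty (Fin m) := ⟨⟨0, hm⟩⟩
  obtain ⟨z, x, -, hx, he⟩ := exists_nonneg_eigenvector (T := D.Astar θ) (Astar_ne_top θ) (c := 0)
    (by simp)
  have hz : (z : ℝ≥0∞) ≤ 1 := (le_pfEigenvalue (Astar_ne_top θ) hx he).trans hθ
  have h : ∀ i, ∑ j, D.Astar θ i j * (x j : ℝ≥0∞) ≤ x i := fun i => by
    rw [he]
    exact mul_le_of_le_one_left zero_le hz
  obtain ⟨k, hk⟩ := Function.ne_iff.1 hx
  refine ⟨x, fun i => ?_, h⟩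
  have := (Astar_irreducible hA θ).superharmonic_pos (v := fun i => (x i : ℝ≥0∞))
    (fun i => by simpa using h i) (j := k) (by simpa using hk) i
  simpa using this

theorem N_ne_top (hm₀ : 0 < m₀) (hm : 0 < m) (hK : NNIrreducible D.K)
    (hA : NNIrreducible (D.Astar 0)) (hΓ : D.GammaPlus.Nonempty) (p q : ℕ × Fin m) :
    D.N p q ≠ ∞ := by
  obtain ⟨θ, hθ⟩ := hΓ
  obtain ⟨x, hxpos, hx⟩ := exists_superharmonic_of_mem_GammaPlus hm hA hθ
  simp_rw [sum_Astar_mul] at hx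
  set e : ℝ≥0∞ := ENNReal.ofReal (Real.exp θ) with he
  set e' : ℝ≥0∞ := ENNReal.ofReal (Real.exp (-θ)) with he'
  have hee : e * e' = 1 := by
    rw [he, he', ← ENNReal.ofReal_mul (Real.exp_pos _).le, ← Real.exp_add]
    simp
  -- The deficit of `e^{nθ} x_i` at the lowest level, where `K₊` has no downward step. As a charge,
  -- it yields `N w ≤ e^{nθ} x_i`.
  let w : Fin m → ℝ≥0∞ := fun i => e' * ∑ j, D.Aneg i j * (x j : ℝ≥0∞)
  have hsup : ∀ r : ℕ × Fin m, (if r.1 = 0 then w r.2 else 0)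
      + ∑' q : ℕ × Fin m, D.Kplus r q * (e ^ q.1 * x q.2) ≤ e ^ r.1 * x r.2 := by
    rintro ⟨_ | n, i⟩
    · rw [tsum_Kplus_zero D i fun q => e ^ q.1 * (x q.2 : ℝ≥0∞)]
      refine le_trans (le_of_eq ?_) ((hx i).trans (by simp))
      simp [w, Finset.mul_sum, mul_left_comm]
    · rw [tsum_Kplus_succ_eq_sum D n i fun q => e ^ q.1 * (x q.2 : ℝ≥0∞), if_neg (Nat.succ_ne_zero n),
        zero_add]
      calc _ = e ^ n * (e * e') * ∑ j, D.Aneg i j * (x j : ℝ≥0∞)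
            + (e ^ (n + 1) * ∑ j, D.Azero i j * (x j : ℝ≥0∞)
              + e ^ (n + 2) * ∑ j, D.Apos i j * (x j : ℝ≥0∞)) := by
            rw [hee, mul_one]
            simp only [Finset.mul_sum, mul_left_comm]
        _ = e ^ (n + 1) * (e' * ∑ j, D.Aneg i j * (x j : ℝ≥0∞)
              + (∑ j, D.Azero i j * (x j : ℝ≥0∞) + e * ∑ j, D.Apos i j * (x j : ℝ≥0∞))) := by ring
        _ ≤ e ^ (n + 1) * x i := by gcongr; exact hx i
  have hcorner : ∀ i l, 0 < D.Aneg i l → D.N p (0, i) ≠ ∞ := by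
    intro i l hil hN
    have h1 := tsum_nnNeumann_mul_le hsup p
    rw [tsum_mul_level_zero w] at h1
    have h2 : D.N p (0, i) * w i ≤ e ^ p.1 * x p.2 :=
      (Finset.single_le_sum (f := fun i => nnNeumann D.Kplus p (0, i) * w i)
        (fun _ _ => zero_le) (Finset.mem_univ i)).trans h1
    have hw : w i ≠ 0 := by
      refine mul_ne_zero (by simp [he', Real.exp_pos]) ?_
      rw [Ne, Finset.sum_eq_zero_iff]
      intro h0
      have := h0 l (Finset.mem_univ l)
      simp [hil.ne', (hxpos l).ne'] at this
    rw [hN, ENNReal.top_mul hw, top_le_iff] at h2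
    exact ENNReal.mul_ne_top (ENNReal.pow_ne_top ENNReal.ofReal_ne_top) ENNReal.coe_ne_top h2
  obtain ⟨n, j⟩ := q
  -- So far only columns with a nonzero row of `A₋₁` are controlled. Any other column leads to such
  -- a one, and an infinite entry would propagate along the path.
  obtain ⟨i, l, hi, hil⟩ := exists_reach_Aneg hm₀ hK n j
  obtain ⟨a, ha⟩ := exists_nnPow_pos_of_reflTransGen hi
  intro hN
  have := nnNeumann_mul_nnPow_le D.Kplus a p (n, j) (0, i)
  rw [show nnNeumann D.Kplus p (n, j) = ∞ from hN, ENNReal.top_mul ha.ne', top_le_iff] at this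
  exact hcorner i l hil this

theorem Gminus_ne_top (hN : ∀ p q, D.N p q ≠ ∞) (i j : Fin m) : D.Gminus i j ≠ ∞ := by
  rw [Gminus_apply]
  exact ENNReal.sum_ne_top.2 fun k _ => ENNReal.mul_ne_top (hN _ _) ENNReal.coe_ne_top

theorem sum_Gminus_pos (hm₀ : 0 < m₀) (hK : NNIrreducible D.K) (i : Fin m) :
    0 < ∑ j, D.Gminus i j := by
  obtain ⟨k, l, hik, hkl⟩ := exists_reach_Aneg hm₀ hK 0 i
  have h1 : 0 < D.N (0, i) (0, k) * D.Aneg k l :=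
    ENNReal.mul_pos (nnNeumann_pos_of_reflTransGen hik).ne' (by simpa using hkl.ne')
  refine h1.trans_le (le_trans ?_ (Finset.single_le_sum (f := fun j => D.Gminus i j)
    (fun _ _ => zero_le) (Finset.mem_univ l)))
  exact Finset.single_le_sum (f := fun k => D.N (0, i) (0, k) * (D.Aneg k l : ℝ≥0∞))
    (fun _ _ => zero_le) (Finset.mem_univ k)

/-- A nonnegative eigenvector of `G₋` for the eigenvalue `e^θ` is superharmonic for `A_*(θ)`. -/
theorem GammaPlus_nonempty_of_Gminus_ne_top (hm₀ : 0 < m₀) (hm : 0 < m) (hK : NNIrreducible D.K)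
    (hA : NNIrreducible (D.Astar 0)) (hG : ∀ i j, D.Gminus i j ≠ ∞) : D.GammaPlus.Nonempty := by
  have : Nonempty (Fin m) := ⟨⟨0, hm⟩⟩
  obtain ⟨i₀, -, hi₀⟩ := Finset.exists_min_image Finset.univ (fun i => ∑ j, D.Gminus i j)
    Finset.univ_nonempty
  have hfin : ∑ j, D.Gminus i₀ j ≠ ∞ := ENNReal.sum_ne_top.2 fun j _ => hG i₀ j
  obtain ⟨z, x, hcz, hx, he⟩ := exists_nonneg_eigenvector hG (c := (∑ j, D.Gminus i₀ j).toNNReal)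
    fun i => by
      rw [ENNReal.coe_toNNReal hfin]
      exact hi₀ i (Finset.mem_univ i)
  -- The eigenvalue is at least the smallest row sum of `G₋`, which is positive.
  have hz : 0 < z := lt_of_lt_of_le
    (ENNReal.toNNReal_pos (sum_Gminus_pos hm₀ hK i₀).ne' hfin) hcz
  have hz0 : (z : ℝ≥0∞) ≠ 0 := by simpa using hz.ne'
  refine ⟨Real.log z, mem_GammaPlus_of_superharmonic hA hx fun i => ?_⟩
  have hexp : ENNReal.ofReal (Real.exp (Real.log z)) = z := by
    rw [Real.exp_log (by exact_mod_cast hz), ENNReal.ofReal_coe_nnreal]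
  have hexp' : ENNReal.ofReal (Real.exp (-Real.log z)) = (z : ℝ≥0∞)⁻¹ := by
    rw [Real.exp_neg, ENNReal.ofReal_inv_of_pos (Real.exp_pos _), hexp]
  rw [sum_Astar_mul, hexp, hexp']
  -- With `G₋ x = z x` this reads `A₋₁ x + z A₀ x + z² A₁ x ≤ z x`, which is `z` times the goal.
  have hq := D.sum_Gminus_quadratic_le (fun j => (x j : ℝ≥0∞)) i
  simp only [he] at hq
  have he2 : ∀ j, ∑ k, D.Gminus j k * ((z : ℝ≥0∞) * x k) = z * (z * x j) := fun j => by
    rw [← he, Finset.mul_sum]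
    simp_rw [mul_left_comm]
  simp only [he2] at hq
  refine (ENNReal.mul_le_mul_iff_right hz0 ENNReal.coe_ne_top).1 (le_trans (le_of_eq ?_) hq)
  rw [mul_add, ← mul_assoc, ENNReal.mul_inv_cancel hz0 ENNReal.coe_ne_top, one_mul, mul_add]
  simp only [Finset.mul_sum, mul_left_comm]

/-! ### The level `0` block of the potential matrix of the canonical form -/

/-- The left-handed counterpart of `sum_Gminus_mul_le`: on levels 1 and up, a row of the potential
dominates the `K₊`-potential of the mass sent up from level 0 by `A₁`. -/
theorem sum_Apos_N_le (p : ℕ × Fin m) (j : Fin m) :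
    ∑ k, (∑ l, nnNeumann D.Kbar p (0, l) * D.Apos l k) * D.N (0, k) (0, j)
      ≤ nnNeumann D.Kbar p (1, j) := by
  have := tsum_mul_nnNeumann_le (T := D.Kplus)
    (b := fun q => if q.1 = 0 then ∑ l, nnNeumann D.Kbar p (0, l) * D.Apos l q.2 else 0)
    (v := fun q => nnNeumann D.Kbar p (q.1 + 1, q.2)) ?_ (0, j)
  · rw [tsum_level_zero_mul (fun k => ∑ l, nnNeumann D.Kbar p (0, l) * D.Apos l k)] at this
    exact this
  · rintro ⟨n, i⟩
    rw [nnNeumann_eq_right D.Kbar p (n + 1, i),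
      tsum_level_split fun k => nnNeumann D.Kbar p k * D.Kbar k (n + 1, i)]
    simp only [Kbar_zero_succ, Kbar_succ_succ]
    refine le_trans (le_of_eq ?_) le_add_self
    congr 1
    split_ifs <;> simp

theorem one_add_le_nnNeumann_Kbar (i j : Fin m) :
    (1 : Matrix (Fin m) (Fin m) ℝ≥0∞) i j
      + ∑ k, nnNeumann D.Kbar (0, i) (0, k) * (D.Czero + nnCoe D.Apos * D.Gminus) k j
      ≤ nnNeumann D.Kbar (0, i) (0, j) := by
  rw [nnNeumann_eq_right D.Kbar (0, i) (0, j), tsum_level_split]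
  simp only [Kbar_zero_zero, Kbar_succ_zero]
  rw [tsum_mul_level_zero (fun k => (D.Aneg k j : ℝ≥0∞))
    fun q => nnNeumann D.Kbar (0, i) (q.1 + 1, q.2)]
  have h1 : (1 : Matrix (ℕ × Fin m) (ℕ × Fin m) ℝ≥0∞) (0, i) (0, j)
      = (1 : Matrix (Fin m) (Fin m) ℝ≥0∞) i j := by
    simp [Matrix.one_apply]
  rw [h1]
  simp only [Matrix.add_apply, mul_add, Finset.sum_add_distrib]
  refine add_le_add le_rfl (add_le_add le_rfl ?_)
  calc ∑ k, nnNeumann D.Kbar (0, i) (0, k) * (nnCoe D.Apos * D.Gminus) k j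
      = ∑ k, (∑ a, (∑ l, nnNeumann D.Kbar (0, i) (0, l) * D.Apos l a) * D.N (0, a) (0, k))
          * D.Aneg k j := by
        let M : Matrix (Fin m) (Fin m) ℝ≥0∞ := Matrix.of fun i k => nnNeumann D.Kbar (0, i) (0, k)
        have : M * (nnCoe D.Apos * D.Gminus) = M * nnCoe D.Apos * D.Ncorner * nnCoe D.Aneg := by
          rw [Gminus, Matrix.mul_assoc, Matrix.mul_assoc]
        exact congrFun (congrFun this i) j
    _ ≤ ∑ k, nnNeumann D.Kbar (0, i) (0 + 1, k) * D.Aneg k j := by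
        gcongr with k
        exact sum_Apos_N_le (0, i) k

theorem exists_nnNeumann_Kbar_eq_top {x : Fin m → ℝ≥0} (hx : x ≠ 0)
    (h : ∀ i, ∑ j, (D.Czero + nnCoe D.Apos * D.Gminus) i j * (x j : ℝ≥0∞) = x i) :
    ∃ i j, nnNeumann D.Kbar (0, i) (0, j) = ∞ := by
  by_contra! hfin
  obtain ⟨i, hi⟩ := Function.ne_iff.1 hx
  have hMx : ∑ j, nnNeumann D.Kbar (0, i) (0, j) * (x j : ℝ≥0∞) ≠ ∞ :=
    ENNReal.sum_ne_top.2 fun j _ => ENNReal.mul_ne_top (hfin i j) ENNReal.coe_ne_top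
  -- Apply `I + M C ≤ M` to `x = C x`: the result `x + M x ≤ M x` is absurd when `M x` is finite and
  -- `x i ≠ 0`.
  have hle : (x i : ℝ≥0∞) + ∑ j, nnNeumann D.Kbar (0, i) (0, j) * (x j : ℝ≥0∞)
      ≤ ∑ j, nnNeumann D.Kbar (0, i) (0, j) * (x j : ℝ≥0∞) := by
    calc (x i : ℝ≥0∞) + ∑ j, nnNeumann D.Kbar (0, i) (0, j) * (x j : ℝ≥0∞)
        = ∑ j, ((1 : Matrix (Fin m) (Fin m) ℝ≥0∞) i j + ∑ k, nnNeumann D.Kbar (0, i) (0, k)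
            * (D.Czero + nnCoe D.Apos * D.Gminus) k j) * (x j : ℝ≥0∞) := by
          simp_rw [add_mul, Finset.sum_add_distrib]
          congr 1
          · exact ((tsum_fintype (L := .unconditional _) _).symm.trans
              (tsum_one_mul (fun j => (x j : ℝ≥0∞)) i)).symm
          · simp_rw [Finset.sum_mul]
            rw [Finset.sum_comm]
            simp_rw [mul_assoc, ← Finset.mul_sum, h]
      _ ≤ _ := by
          gcongr with j
          exact one_add_le_nnNeumann_Kbar i j
  have h0 : (x i : ℝ≥0∞) = 0 := by
    by_contra h0
    exact absurd hle (not_le.2 (by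
      rw [add_comm]; exact ENNReal.lt_add_right hMx h0))
  exact hi (by simpa using h0)

/-! ### From the canonical matrix to the convergence parameter of `K̄`. -/

theorem one_le_convParam_Kbar_of_superharmonic (hK : NNIrreducible D.K)
    (hN : ∀ p q, D.N p q ≠ ∞) {x : Fin m → ℝ≥0} (hx : x ≠ 0)
    (h : ∀ i, ∑ j, (D.Czero + nnCoe D.Apos * D.Gminus) i j * (x j : ℝ≥0∞) ≤ x i) :
    1 ≤ convParam D.Kbar ∧ ∀ i, 0 < x i := by
  obtain ⟨k, hk⟩ := Function.ne_iff.1 hx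
  have hsup := D.harmonicExtension_superharmonic h
  have hpos := (Kbar_irreducible hK).superharmonic_pos hsup (j := (0, k))
    (by simpa [harmonicExtension_zero] using hk)
  exact ⟨one_le_convParam_of_superharmonic hsup hpos
    (D.harmonicExtension_ne_top hN fun i => ENNReal.coe_ne_top),
    fun i => by simpa [harmonicExtension_zero] using hpos (0, i)⟩

theorem exists_canonical_eigenvector (hm : 0 < m)
    (h : pfEigenvalue (D.Czero + nnCoe D.Apos * D.Gminus) ≤ 1) :
    ∃ (z : ℝ≥0) (x : Fin m → ℝ≥0), (z : ℝ≥0∞) ≤ 1 ∧ x ≠ 0 ∧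
      ∀ i, ∑ j, (D.Czero + nnCoe D.Apos * D.Gminus) i j * (x j : ℝ≥0∞) = z * x i := by
  have : Nonempty (Fin m) := ⟨⟨0, hm⟩⟩
  have hfin := ne_top_of_pfEigenvalue_ne_top (h.trans_lt ENNReal.one_lt_top).ne
  obtain ⟨z, x, -, hx, he⟩ := exists_nonneg_eigenvector hfin (c := 0) (by simp)
  exact ⟨z, x, (le_pfEigenvalue hfin hx he).trans h, hx, he⟩

end QBDBlocks

theorem mainTheorem2 {m₀ m : ℕ} (hm₀ : 0 < m₀) (hm : 0 < m) (D : QBDBlocks m₀ m)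
    (hK : NNIrreducible D.K) (hA : NNIrreducible (D.Astar 0)) :
    (D.GammaPlus.Nonempty →
      (∀ p q, D.N p q ≠ ∞) ∧ (∀ i j, D.Gminus i j ≠ ∞)) ∧
    (1 ≤ convParam D.Kbar ↔
      D.GammaPlus.Nonempty ∧ pfEigenvalue (D.Czero + nnCoe D.Apos * D.Gminus) ≤ 1) ∧
    (D.GammaPlus.Nonempty →
      pfEigenvalue (D.Czero + nnCoe D.Apos * D.Gminus) = 1 → convParam D.Kbar = 1) := by
  have hN : D.GammaPlus.Nonempty → ∀ p q, D.N p q ≠ ∞ := fun hΓ =>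
    QBDBlocks.N_ne_top hm₀ hm hK hA hΓ
  refine ⟨fun hΓ => ⟨hN hΓ, QBDBlocks.Gminus_ne_top (hN hΓ)⟩, ⟨fun h1 => ?_, ?_⟩, fun hΓ hpf => ?_⟩
  · have : Nonempty (ℕ × Fin m) := ⟨(0, ⟨0, hm⟩)⟩
    obtain ⟨v, hv, hpos, hfin⟩ := (QBDBlocks.Kbar_irreducible hK).exists_superharmonic h1
    -- Finiteness of `G₋` comes from `G₋ v₀ ≤ v₁` with `v` positive and finite, so `Γ₊` need not be
    -- known to be nonempty beforehand.
    refine ⟨QBDBlocks.GammaPlus_nonempty_of_Gminus_ne_top hm₀ hm hK hA fun i j hij => ?_,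
      pfEigenvalue_le_of_superharmonic (v := fun j => v (0, j)) ENNReal.one_ne_top
        (fun i => by simpa using D.sum_canonical_mul_le hv i) (fun i => hpos _) fun i => hfin _⟩
    have h2 := D.sum_Gminus_mul_le
      (fun n i => (D.tsum_Kbar_succ n i v).symm.le.trans (hv (n + 1, i))) i
    have h3 := (Finset.single_le_sum (f := fun j => D.Gminus i j * v (0, j))
      (fun _ _ => zero_le) (Finset.mem_univ j)).trans h2
    rw [hij, ENNReal.top_mul (hpos _).ne', top_le_iff] at h3
    exact hfin _ h3
  · rintro ⟨hΓ, hpf⟩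
    obtain ⟨z, x, hz, hx, he⟩ := QBDBlocks.exists_canonical_eigenvector hm hpf
    exact (QBDBlocks.one_le_convParam_Kbar_of_superharmonic hK (hN hΓ) hx fun i =>
      (he i).le.trans (mul_le_of_le_one_left zero_le hz)).1
  · obtain ⟨z, x, hz, hx, he⟩ := QBDBlocks.exists_canonical_eigenvector hm hpf.le
    obtain ⟨h1, hpos⟩ := QBDBlocks.one_le_convParam_Kbar_of_superharmonic hK (hN hΓ) hx fun i =>
      (he i).le.trans (mul_le_of_le_one_left zero_le hz)
    -- Irreducibility of `K̄` made `x` positive, so every eigenvalue counted by `pfEigenvalue` is at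
    -- most `z`; hence `1 ≤ z`.
    have hz1 : (z : ℝ≥0∞) = 1 := by
      refine le_antisymm hz (hpf.symm.le.trans ?_)
      exact pfEigenvalue_le_of_superharmonic (v := fun i => (x i : ℝ≥0∞)) ENNReal.coe_ne_top
        (fun i => (he i).le) (fun i => by simpa using hpos i) fun i => ENNReal.coe_ne_top
    obtain ⟨i, j, hij⟩ := QBDBlocks.exists_nnNeumann_Kbar_eq_top hx fun i => by
      rw [he, hz1, one_mul]
    exact le_antisymm (convParam_le_one_of_nnNeumann_eq_top hij) h1
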